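/- **Setting.** Let $\mathcal X\subset\mathbb R^d$ and let $k:\mathcal X\times\mathcal X\to(0,\infty)$ be a covariance function (continuous, symmetric, all Gram matrices positive semidefinite). Let $x_1,\dots,x_n\in\mathcal X$ be inputs whose Gram matrix $K_{ff}$ is positive definite, let $x^*_1,\dots,x^*_{n_*}\in\mathcal X$ be new inputs, and let $y$ be the outputs. The likelihood $f\mapsto p(y\mid f)$ on $\mathbb R^n$ is nonnegative and not identically zero, and it and its gradient are differentiable and bounded. With $p(f)=\mathcal N(0,K_{ff})$ and $p(f_*\mid f)=\mathcal N(K_{*f}K_{ff}^{-1}f,\;K_{**}-K_{*f}K_{ff}^{-1}K_{f*})$, put $$\mathcal L=\log\int_{\mathbb R^n}p(y\mid f)\,p(f)\,df,\qquad p(f_*\mid y)=e^{-\mathcal L}\int_{\mathbb R^n}p(f_*\mid f)\,p(y\mid f)\,p(f)\,df .$$ Summarized inputs consist of some $m\ge 1$, representative features $z_1,\dots,z_m\in\mathcal X$ and an assignment $\omega:\{1,\dots,n\}\to\{1,\dots,m\}$ that takes every value. Let $K_{uu}$, $K_{fu}$, $K_{uf}=K_{fu}^\top$ be the Gram matrices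 of $(Z,Z)$, $(X,Z)$, $(Z,X)$, let $W\in\mathbb R^{n\times m}$ have entries $W_{ij}=1$ if $\omega_i=j$ and $0$ otherwise, and assume that $K_{uu}$ is positive definite and $W\ne K_{fu}K_{uu}^{-1}$. With $p(u)=\mathcal N(0,K_{uu})$, put $$\mathcal E=\log\int_{\mathbb R^m}p(y\mid Wu)\,p(u)\,du,\qquad p(f_*\mid y,\omega)=e^{-\mathcal E}\int_{\mathbb R^m}p(f_*\mid Wu)\,p(y\mid Wu)\,p(u)\,du .$$ Let $\lambda_1$, $\lambda_2$ be the largest eigenvalues of $K_{uu}$ and $K_{ff}-K_{fu}K_{uu}^{-1}K_{uf}$, let $$\kappa=\inf\Bigl\{\tfrac nm|u|^2:\ u\in\mathbb R^m,\ |(W-K_{fu}K_{uu}^{-1})u|=1\Bigr\},\qquad F(a,b)=\frac{\int_{b/2}^\infty t^{a/2-1}e^{-t}\,dt}{\int_0^\infty t^{a/2-1}e^{-t}\,dt},$$ let $\xi_0$ be the larger solution of $2\sqrt{\pi\xi}\,e^{-\xi}=1$, and put $$\eta=\inf_{\xi\ge\xi_0}\Bigl(\sqrt{\xi\lambda_1\kappa^{-1}}+\sqrt{\xi\lambda_2}+F(m,\xi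 m)\Bigr).$$ **Theorem.** Fix $\mathcal X$, $k$, the inputs, the new inputs, the outputs and the likelihood. The marginal likelihood $e^{\mathcal L}$ is positive and $p(f_*\mid y)$ is a probability law with finite mean. Moreover $$\mathcal L-\mathcal E=O(\eta),\qquad \bigl\|\mathbb E_{p(f_*\mid y)}[f_*]-\mathbb E_{p(f_*\mid y,\omega)}[f_*]\bigr\|=O(\eta),$$ uniformly over the summarized inputs, in the following sense. 1. There are $C>0$ and $\eta_0>0$ such that for all summarized inputs $(m,Z,\omega)$ as above with $\eta\le\eta_0$: $\int p(y\mid Wu)p(u)\,du>0$, $p(f_*\mid y,\omega)$ is a probability law with finite mean, $|\mathcal L-\mathcal E|\le C\eta$, and $\|\mathbb E_{p(f_*\mid y)}[f_*]-\mathbb E_{p(f_*\mid y,\omega)}[f_*]\|\le C\eta$. 2. If moreover $p(y\mid f)>0$ at $f=0$ (for instance if the likelihood is positive everywhere), then for every $B$ there is $C>0$ such that the conclusions of 1 hold for all summarized inputs as above with $k(z_j,z_j)\le B$ for all $j$, without any restriction on $\eta$. When a Gaussian covariance is singular, $\mathcal N$ denotes the corresponding degenerate Gaussian law, and the posteriors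 are the corresponding mixtures. -/

import Mathlib

open MeasureTheory ProbabilityTheory Matrix

noncomputable section

namespace GPSummary

/-- The Euclidean space of dimension `n`. -/
abbrev Vec (n : ℕ) := EuclideanSpace ℝ (Fin n)

/-- A matrix acting on Euclidean vectors. -/
def act {p q : ℕ} (A : Matrix (Fin p) (Fin q) ℝ) (v : Vec q) : Vec p :=
  WithLp.toLp 2 (A *ᵥ v.ofLp)

/-- The Gram matrix of `(a, b)` for the covariance function `k`. -/
def gram {α : Type*} (k : α → α → ℝ) {p q : ℕ} (a : Fin p → α) (b : Fin q → α) :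
    Matrix (Fin p) (Fin q) ℝ :=
  Matrix.of fun i j => k (a i) (b j)

/-- Covariance functions: continuous symmetric kernels with values in `(0, ∞)` that are positive
semidefinite, i.e. covariances of a Gaussian process. -/
structure IsCovarianceFunction {α : Type*} [TopologicalSpace α] (k : α → α → ℝ) : Prop where
  pos : ∀ a b, 0 < k a b
  symm : ∀ a b, k a b = k b a
  continuous : Continuous fun p : α × α => k p.1 p.2
  posSemidef : ∀ (r : ℕ) (a : Fin r → α), (gram k a a).PosSemidef

/-- Regularity of a likelihood function `f ↦ p(y | f)`: it is nonnegative, and it and its gradient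
are differentiable and bounded. -/
structure IsLikelihood {n : ℕ} (ℓ : Vec n → ℝ) : Prop where
  nonneg : ∀ f, 0 ≤ ℓ f
  differentiable : Differentiable ℝ ℓ
  bounded : ∃ B, ∀ f, ℓ f ≤ B
  differentiable_gradient : Differentiable ℝ (gradient ℓ)
  bounded_gradient : ∃ B, ∀ f, ‖gradient ℓ f‖ ≤ B

/-- The input part of summarized data for `n` data points: `m` representative features `z j`, and
an assignment `ω` of the data points to them for which every count `n_j` is positive. -/
structure Summary (α : Type*) (n : ℕ) where
  m : ℕ
  z : Fin m → α
  ω : Fin n → Fin m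
  count_pos : ∀ j, 0 < (Finset.univ.filter fun i => ω i = j).card

section Models

variable {α : Type*} {n nStar : ℕ} (k : α → α → ℝ) (x : Fin n → α) (xStar : Fin nStar → α)
  (ℓ : Vec n → ℝ) (S : Summary α n)

/-- The assignment matrix `W_fu`. -/
def Summary.W : Matrix (Fin n) (Fin S.m) ℝ :=
  Matrix.of fun i j => if S.ω i = j then 1 else 0

/-- The prior law `N(0, K_aa)` of the values of the Gaussian process at the points `a`. -/
def prior {p : ℕ} (a : Fin p → α) : Measure (Vec p) :=
  multivariateGaussian 0 (gram k a a)

/-- The law `p(f_* | f) = N(K_*f K_ff⁻¹ f, K_** - K_*f K_ff⁻¹ K_f*)`. -/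
def condLaw (f : Vec n) : Measure (Vec nStar) :=
  multivariateGaussian (act (gram k xStar x * (gram k x x)⁻¹) f)
    (gram k xStar xStar - gram k xStar x * (gram k x x)⁻¹ * gram k x xStar)

/-- The marginal likelihood `∫ p(y | f) p(f) df` of the full model. -/
def marginal : ℝ := ∫ f, ℓ f ∂(prior k x)

/-- The log marginal likelihood `𝓛` of the full model. -/
def logMarginal : ℝ := Real.log (marginal k x ℓ)

/-- The marginal likelihood `∫ p(y | W u) p(u) du` of the model on representative features. -/
def reprMarginal : ℝ := ∫ u, ℓ (act S.W u) ∂(prior k S.z)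

/-- The log marginal likelihood `𝓔` of the model on representative features. -/
def reprLogMarginal : ℝ := Real.log (reprMarginal k ℓ S)

/-- The posterior law `exp(-𝓛) ∫ p(f_* | f) p(y | f) p(f) df` of `f_*` in the full model. -/
def posterior : Measure (Vec nStar) :=
  ENNReal.ofReal (Real.exp (-logMarginal k x ℓ)) •
    ((prior k x).withDensity fun f => ENNReal.ofReal (ℓ f)).bind (condLaw k x xStar)

/-- The posterior law `exp(-𝓔) ∫ p(f_* | W u) p(y | W u) p(u) du` of `f_*` in the model on
representative features. -/
def reprPosterior : Measure (Vec nStar) :=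
  ENNReal.ofReal (Real.exp (-reprLogMarginal k ℓ S)) •
    ((prior k S.z).withDensity fun u => ENNReal.ofReal (ℓ (act S.W u))).bind
      fun u => condLaw k x xStar (act S.W u)

/-- The matrix `W_fu - K_fu K_uu⁻¹`. -/
def residual : Matrix (Fin n) (Fin S.m) ℝ :=
  S.W - gram k x S.z * (gram k S.z S.z)⁻¹

/-- The maximum eigenvalue of a symmetric real matrix. -/
def maxEigenvalue {p : ℕ} (A : Matrix (Fin p) (Fin p) ℝ) : ℝ := sSup (spectrum ℝ A)

/-- `κ = inf { (n / m) |u|² : |(W_fu - K_fu K_uu⁻¹) u| = 1 }`. -/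
def kappa : ℝ :=
  sInf ((fun u : Vec S.m => (n : ℝ) / (S.m : ℝ) * ‖u‖ ^ 2) ''
    {u | ‖act (residual k x S) u‖ = 1})

/-- `λ₁`, the maximum eigenvalue of `K_uu`. -/
def lambda₁ : ℝ := maxEigenvalue (gram k S.z S.z)

/-- `λ₂`, the maximum eigenvalue of `K_ff - K_fu K_uu⁻¹ K_uf`. -/
def lambda₂ : ℝ :=
  maxEigenvalue (gram k x x - gram k x S.z * (gram k S.z S.z)⁻¹ * gram k S.z x)

/-- The upper cumulative distribution function of the chi-square distribution with `a` degrees of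
freedom. -/
def chiSqTail (a : ℕ) (b : ℝ) : ℝ :=
  (∫ t in Set.Ioi (0 : ℝ), t ^ ((a : ℝ) / 2 - 1) * Real.exp (-t))⁻¹ *
    ∫ t in Set.Ioi (b / 2), t ^ ((a : ℝ) / 2 - 1) * Real.exp (-t)

/-- `ξ₀`, the larger solution of `2 √(π ξ) exp(-ξ) = 1`. -/
def xi₀ : ℝ := sSup {ξ : ℝ | 2 * Real.sqrt (Real.pi * ξ) * Real.exp (-ξ) = 1}

/-- `η = inf_{ξ ≥ ξ₀} (√(ξ λ₁ κ⁻¹) + √(ξ λ₂) + F(m, ξ m))`. -/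
def eta : ℝ :=
  ⨅ ξ : Set.Ici xi₀, (Real.sqrt (ξ * lambda₁ k S * (kappa k x S)⁻¹) +
    Real.sqrt (ξ * lambda₂ k x S) + chiSqTail S.m (ξ * S.m))

/-- Summarized data for which the quantities above make sense: `K_uu` is positive definite, and
`W_fu - K_fu K_uu⁻¹` is not zero (its largest absolute entry `γ` is not zero). -/
structure Summary.Admissible : Prop where
  posDef : (gram k S.z S.z).PosDef
  residual_ne_zero : residual k x S ≠ 0

/-- The two approximation bounds with constant `C`, together with the fact that `𝓔` and the
posterior mean are genuine: the marginal likelihood is positive, and `f_*` is integrable under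
the posterior law, which is a probability law. -/
structure Summary.Bounds (C : ℝ) : Prop where
  marginal_pos : 0 < reprMarginal k ℓ S
  logMarginal_sub : |logMarginal k x ℓ - reprLogMarginal k ℓ S| ≤ C * eta k x S
  isProbability : IsProbabilityMeasure (reprPosterior k x xStar ℓ S)
  integrable : Integrable (fun v => v) (reprPosterior k x xStar ℓ S)
  mean_sub : ‖(∫ v, v ∂(posterior k x xStar ℓ)) - ∫ v, v ∂(reprPosterior k x xStar ℓ S)‖ ≤
    C * eta k x S

end Models

/-- `xi₀` is a genuine maximum. -/
theorem xi₀_isGreatest :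
    IsGreatest {ξ : ℝ | 2 * Real.sqrt (Real.pi * ξ) * Real.exp (-ξ) = 1} xi₀ := by
  have hc : Continuous fun ξ : ℝ => 2 * Real.sqrt (Real.pi * ξ) * Real.exp (-ξ) := by fun_prop
  have hb : ∀ ξ ∈ {ξ : ℝ | 2 * Real.sqrt (Real.pi * ξ) * Real.exp (-ξ) = 1}, ξ ≤ 16 := by
    intro ξ hξ
    by_contra! h
    have h1 : Real.sqrt (Real.pi * ξ) ≤ 2 * ξ := by
      rw [Real.sqrt_le_left (by positivity)]
      nlinarith [Real.pi_le_four]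
    have h2 : (ξ / 2 + 1) ^ 2 ≤ Real.exp ξ := by
      have := Real.add_one_le_exp (ξ / 2)
      calc (ξ / 2 + 1) ^ 2 ≤ Real.exp (ξ / 2) ^ 2 := by gcongr
        _ = Real.exp ξ := by rw [← Real.exp_nat_mul]; congr 1; push_cast; ring
    have h3 : 2 * Real.sqrt (Real.pi * ξ) = Real.exp ξ := by
      have : Real.exp (-ξ) * Real.exp ξ = 1 := by rw [← Real.exp_add]; simp
      have h4 : 2 * Real.sqrt (Real.pi * ξ) * Real.exp (-ξ) = 1 := hξ
      linear_combination (-(2 * Real.sqrt (Real.pi * ξ))) * this + Real.exp ξ * h4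
    nlinarith
  have hne : {ξ : ℝ | 2 * Real.sqrt (Real.pi * ξ) * Real.exp (-ξ) = 1}.Nonempty := by
    have h0 : 2 * Real.sqrt (Real.pi * 0) * Real.exp (-0) ≤ 1 := by simp
    have h1 : 1 ≤ 2 * Real.sqrt (Real.pi * 1) * Real.exp (-1) := by
      have : (1.7:ℝ) ≤ Real.sqrt (Real.pi * 1) := by
        apply Real.le_sqrt_of_sq_le
        nlinarith [Real.pi_gt_three]
      rw [Real.exp_neg]
      have := Real.exp_one_lt_d9
      rw [← div_eq_mul_inv, le_div_iff₀ (Real.exp_pos 1)]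
      linarith
    obtain ⟨ξ, -, h⟩ := intermediate_value_Icc (zero_le_one) hc.continuousOn ⟨h0, h1⟩
    exact ⟨ξ, h⟩
  exact ⟨(isClosed_singleton.preimage hc).csSup_mem hne ⟨16, hb⟩,
    fun ξ h => le_csSup ⟨16, hb⟩ h⟩

open scoped MatrixOrder in
/-- `condLaw` is measurable, so the mixtures in the posterior laws are genuine. -/
theorem measurable_condLaw {α : Type*} {n nStar : ℕ} (k : α → α → ℝ) (x : Fin n → α)
    (xStar : Fin nStar → α) : Measurable (condLaw k x xStar) := by
  unfold condLaw multivariateGaussian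
  have ha : Measurable fun f : Vec n => act (gram k xStar x * (gram k x x)⁻¹) f := by
    unfold act
    fun_prop
  refine Measure.measurable_of_measurable_coe _ fun s hs => ?_
  have hT : Measurable fun q : Vec n × Vec nStar =>
      act (gram k xStar x * (gram k x x)⁻¹) q.1 + toEuclideanCLM (𝕜 := ℝ) (CFC.sqrt
        (gram k xStar xStar - gram k xStar x * (gram k x x)⁻¹ * gram k x xStar)) q.2 := by
    fun_prop
  convert measurable_measure_prodMk_left (ν := stdGaussian (Vec nStar)) (hT hs) using 2 with f
  rw [Measure.map_apply (by fun_prop) hs]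
  rfl

end GPSummary

end

noncomputable section

namespace GPSummary

open scoped RealInnerProductSpace

/-! The two models are compared by a coupling. Let `u` have the feature prior, let `e` be an
independent centred Gaussian whose covariance is the Schur complement of `K_uu`, and put `f = K_fu
K_uu⁻¹ u + e`. Then `f` has the full prior (`map_coupling_eq_prior`) and `f - W u = e - R u`, with
`R` the residual matrix. The definition of `κ` bounds `|R u|²` by `(n/m) κ⁻¹ |u|²`, and a trace is
at most the dimension times the largest eigenvalue, so the mean square of `f - W u` is at most
`2n(λ₁κ⁻¹ + λ₂)`. This is `O(η²)`, since `ξ` stays above the positive constant `ξ₀`; of the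
chi-square tail only nonnegativity matters (`integral_coupling_sq_le`).

The likelihood is bounded and Lipschitz, so the marginal likelihoods, and likewise the integrals of
`ℓ(f) f`, differ by `O(η)` (`exists_coupling_bounds`). A posterior mean of `f_*` is a fixed linear
map applied to the quotient of these two integrals (`mixture_condLaw`). Logarithms and quotients
preserve `O(η)` once both marginal likelihoods are bounded below. For the summarized model this
comes either from small `η`, by comparison with the full model, or from `ℓ(0) > 0` and bounded
feature variances (`exists_le_reprMarginal`). -/

/-! ### Matrices acting on Euclidean vectors. -/

theorem act_eq_toEuclideanLin {p q : ℕ} (A : Matrix (Fin p) (Fin q) ℝ) :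
    act A = LinearMap.toContinuousLinearMap (toEuclideanLin A) := rfl

theorem continuous_act {p q : ℕ} (A : Matrix (Fin p) (Fin q) ℝ) : Continuous (act A) := by
  rw [act_eq_toEuclideanLin]; exact ContinuousLinearMap.continuous _

theorem act_smul {p q : ℕ} (A : Matrix (Fin p) (Fin q) ℝ) (c : ℝ) (v : Vec q) :
    act A (c • v) = c • act A v := by
  rw [act_eq_toEuclideanLin, map_smul]

theorem act_sub_left {p q : ℕ} (A B : Matrix (Fin p) (Fin q) ℝ) (v : Vec q) :
    act (A - B) v = act A v - act B v := by
  simp [act, Matrix.sub_mulVec]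

theorem inner_act_left {p q : ℕ} (A : Matrix (Fin p) (Fin q) ℝ) (u : Vec q) (v : Vec p) :
    ⟪act A u, v⟫ = ⟪u, act Aᵀ v⟫ := by
  simp only [act, EuclideanSpace.inner_eq_star_dotProduct, star_trivial]
  rw [dotProduct_mulVec, ← mulVec_transpose, dotProduct_comm]

/-- The Frobenius bound for the action of a matrix. -/
theorem norm_act_sq_le {p q : ℕ} (A : Matrix (Fin p) (Fin q) ℝ) (v : Vec q) :
    ‖act A v‖ ^ 2 ≤ (∑ i, ∑ j, A i j ^ 2) * ‖v‖ ^ 2 := by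
  rw [EuclideanSpace.norm_sq_eq, EuclideanSpace.norm_sq_eq, Finset.sum_mul]
  refine Finset.sum_le_sum fun i _ => ?_
  simp only [act, mulVec, dotProduct, Real.norm_eq_abs, sq_abs]
  exact Finset.sum_mul_sq_le_sq_mul_sq _ _ _

/-! ### Gaussian vectors: second moments, linear images, full support. -/

theorem memLp_multivariateGaussian {p : ℕ} (μ : Vec p) (S : Matrix (Fin p) (Fin p) ℝ) :
    MemLp (fun v => v) 2 (multivariateGaussian μ S) :=
  IsGaussian.memLp_two_id

theorem integral_norm_sq_multivariateGaussian {p : ℕ} {S : Matrix (Fin p) (Fin p) ℝ}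
    (hS : S.PosSemidef) : ∫ v, ‖v‖ ^ 2 ∂(multivariateGaussian 0 S) = S.trace := by
  have hm : ∀ i : Fin p, MemLp (fun v : Vec p => v i) 2 (multivariateGaussian 0 S) := fun i =>
    (EuclideanSpace.proj (𝕜 := ℝ) i).comp_memLp' (memLp_multivariateGaussian 0 S)
  simp only [EuclideanSpace.norm_sq_eq, Real.norm_eq_abs, sq_abs]
  rw [integral_finsetSum _ fun i _ => (hm i).integrable_sq]
  refine Finset.sum_congr rfl fun i _ => ?_
  have h0 : ∫ v, v i ∂(multivariateGaussian 0 S) = 0 := by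
    have := (EuclideanSpace.proj (𝕜 := ℝ) i).integral_comp_comm
      ((memLp_multivariateGaussian 0 S).integrable one_le_two)
    simpa using this
  have := variance_of_integral_eq_zero (hm i).aemeasurable h0
  rw [variance_eval_multivariateGaussian hS] at this
  exact this.symm

/-- A linear image of a centred Gaussian vector plus independent centred Gaussian noise. -/
theorem map_act_add_prod {p q : ℕ} {K : Matrix (Fin q) (Fin q) ℝ} {T : Matrix (Fin p) (Fin p) ℝ}
    {Q : Matrix (Fin p) (Fin q) ℝ} (hK : K.PosSemidef) (hT : T.PosSemidef) :
    ((multivariateGaussian 0 K).prod (multivariateGaussian 0 T)).map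
      (fun w => act Q w.1 + w.2) = multivariateGaussian 0 (Q * K * Qᵀ + T) := by
  have hS : (Q * K * Qᵀ + T).PosSemidef := by
    have := hK.mul_mul_conjTranspose_same Q
    rw [conjTranspose_eq_transpose_of_trivial] at this
    exact this.add hT
  have hc : Continuous fun w : Vec q × Vec p => act Q w.1 + w.2 :=
    ((continuous_act Q).comp continuous_fst).add continuous_snd
  have : IsProbabilityMeasure (((multivariateGaussian 0 K).prod (multivariateGaussian 0 T)).map
      (fun w => act Q w.1 + w.2)) := Measure.isProbabilityMeasure_map hc.aemeasurable
  -- Characteristic functions determine the law, and independence turns the one of the sum into a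
  -- product.
  refine Measure.ext_of_charFun (funext fun t => ?_)
  rw [charFun_multivariateGaussian hS, charFun_apply,
    integral_map hc.aemeasurable (by fun_prop)]
  have h1 : ∀ w : Vec q × Vec p, Complex.exp (⟪act Q w.1 + w.2, t⟫ * Complex.I) =
      Complex.exp (⟪w.1, act Qᵀ t⟫ * Complex.I) * Complex.exp (⟪w.2, t⟫ * Complex.I) := by
    intro w
    rw [inner_add_left, inner_act_left, ← Complex.exp_add]
    push_cast; ring_nf
  simp_rw [h1]
  rw [integral_prod_mul (fun u : Vec q => Complex.exp (⟪u, act Qᵀ t⟫ * Complex.I))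
    (fun e : Vec p => Complex.exp (⟪e, t⟫ * Complex.I)), ← charFun_apply, ← charFun_apply,
    charFun_multivariateGaussian hK, charFun_multivariateGaussian hT, ← Complex.exp_add]
  congr 1
  have h2 : (act Qᵀ t).ofLp ⬝ᵥ K *ᵥ (act Qᵀ t).ofLp = t.ofLp ⬝ᵥ (Q * K * Qᵀ) *ᵥ t.ofLp := by
    simp only [act]
    rw [← mulVec_mulVec, ← mulVec_mulVec, dotProduct_mulVec t.ofLp, ← mulVec_transpose]
  rw [h2, add_mulVec, dotProduct_add]
  simp
  ring

theorem isOpenPosMeasure_stdGaussian (p : ℕ) : (stdGaussian (Vec p)).IsOpenPosMeasure := by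
  rw [← map_pi_eq_stdGaussian]
  have : (gaussianReal 0 1).IsOpenPosMeasure :=
    (gaussianReal_absolutelyContinuous' 0 one_ne_zero).isOpenPosMeasure
  exact (PiLp.continuous_toLp 2 _).isOpenPosMeasure_map (WithLp.toLp_surjective 2)

open scoped MatrixOrder in
theorem multivariateGaussian_zero_eq_map {p : ℕ} (S : Matrix (Fin p) (Fin p) ℝ) :
    multivariateGaussian 0 S = (stdGaussian (Vec p)).map (act (CFC.sqrt S)) := by
  unfold multivariateGaussian
  congr 1
  ext1 v
  simp only [zero_add]
  rfl

-- The square root of `S` has the right inverse `√S S⁻¹`, hence is surjective and carries the full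
-- support of the standard Gaussian over.
open scoped MatrixOrder in
theorem isOpenPosMeasure_multivariateGaussian {p : ℕ} {S : Matrix (Fin p) (Fin p) ℝ}
    (hS : S.PosDef) : (multivariateGaussian 0 S).IsOpenPosMeasure := by
  have := isOpenPosMeasure_stdGaussian p
  rw [multivariateGaussian_zero_eq_map]
  refine (continuous_act _).isOpenPosMeasure_map fun v => ⟨act (CFC.sqrt S * S⁻¹) v, ?_⟩
  have h : CFC.sqrt S * (CFC.sqrt S * S⁻¹) = 1 := by
    rw [← mul_assoc, CFC.sqrt_mul_sqrt_self S hS.posSemidef.nonneg,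
      mul_nonsing_inv _ ((isUnit_iff_isUnit_det S).1 hS.isUnit)]
  simp [act, mulVec_mulVec, h]

-- The squared Frobenius norm of the symmetric matrix `√S` is the trace of `√S √S = S`.
open scoped MatrixOrder in
theorem norm_act_sqrt_sq_le {p : ℕ} {S : Matrix (Fin p) (Fin p) ℝ} (hS : S.PosSemidef)
    (v : Vec p) : ‖act (CFC.sqrt S) v‖ ^ 2 ≤ S.trace * ‖v‖ ^ 2 := by
  have h := norm_act_sq_le (CFC.sqrt S) v
  have hs : (CFC.sqrt S).IsHermitian := (CFC.sqrt_nonneg S).posSemidef.1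
  have e : ∑ i, ∑ j, CFC.sqrt S i j ^ 2 = S.trace := by
    conv_rhs => rw [← CFC.sqrt_mul_sqrt_self S hS.nonneg]
    simp only [trace, diag, mul_apply]
    refine Finset.sum_congr rfl fun i _ => Finset.sum_congr rfl fun j _ => ?_
    rw [pow_two]
    congr 1
    simpa using (hs.apply i j).symm
  rwa [e] at h

theorem trace_le_maxEigenvalue {p : ℕ} {S : Matrix (Fin p) (Fin p) ℝ} (hS : S.IsHermitian) :
    S.trace ≤ p * maxEigenvalue S := by
  rw [hS.trace_eq_sum_eigenvalues]
  have : ∀ i, hS.eigenvalues i ≤ maxEigenvalue S := fun i => by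
    rw [maxEigenvalue, hS.spectrum_real_eq_range_eigenvalues]
    exact le_csSup (Set.finite_range _).bddAbove ⟨i, rfl⟩
  simpa using Finset.sum_le_sum fun i (_ : i ∈ Finset.univ) => this i

/-! ### Perturbation of likelihood integrals under a coupling. -/

section Coupling

variable {Ω : Type*} [MeasurableSpace Ω] {P : Measure Ω} {n : ℕ}
  {f g : Ω → Vec n} {ℓ : Vec n → ℝ} {B L : ℝ}

/-- The Cauchy-Schwarz inequality for norms of random vectors. -/
theorem integral_norm_mul_norm_le {E F : Type*} [NormedAddCommGroup E] [NormedAddCommGroup F]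
    {f : Ω → E} {g : Ω → F} (hf : MemLp f 2 P) (hg : MemLp g 2 P) :
    ∫ w, ‖f w‖ * ‖g w‖ ∂P ≤ √(∫ w, ‖f w‖ ^ 2 ∂P) * √(∫ w, ‖g w‖ ^ 2 ∂P) := by
  have := integral_mul_norm_le_Lp_mul_Lq (μ := P) Real.HolderConjugate.two_two
    (f := fun w => ‖f w‖) (g := fun w => ‖g w‖) (by simpa using hf.norm) (by simpa using hg.norm)
  simpa [Real.sqrt_eq_rpow] using this

theorem integral_norm_le_sqrt [IsProbabilityMeasure P] {E : Type*} [NormedAddCommGroup E] {f : Ω → E}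
    (hf : MemLp f 2 P) : ∫ w, ‖f w‖ ∂P ≤ √(∫ w, ‖f w‖ ^ 2 ∂P) := by
  simpa using integral_norm_mul_norm_le hf (memLp_const (1 : ℝ) (μ := P) (p := 2))

theorem integrable_likelihood_comp [IsProbabilityMeasure P] (hℓ : Continuous ℓ) (h0 : ∀ v, 0 ≤ ℓ v) (hB : ∀ v, ℓ v ≤ B)
    (hf : AEStronglyMeasurable f P) : Integrable (fun w => ℓ (f w)) P :=
  .of_bound (hℓ.comp_aestronglyMeasurable hf) B
    (.of_forall fun w => by rw [Real.norm_of_nonneg (h0 _)]; exact hB _)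

theorem integrable_likelihood_smul (hℓ : Continuous ℓ) (h0 : ∀ v, 0 ≤ ℓ v) (hB : ∀ v, ℓ v ≤ B)
    (hf : Integrable f P) : Integrable (fun w => ℓ (f w) • f w) P :=
  hf.bdd_smul B (hℓ.comp_aestronglyMeasurable hf.1)
    (.of_forall fun w => by rw [Real.norm_of_nonneg (h0 _)]; exact hB _)

theorem abs_integral_likelihood_sub_le [IsProbabilityMeasure P] (hℓ : Continuous ℓ) (h0 : ∀ v, 0 ≤ ℓ v)
    (hB : ∀ v, ℓ v ≤ B) (hL : ∀ v w, |ℓ v - ℓ w| ≤ L * ‖v - w‖) (hL0 : 0 ≤ L)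
    (hf : MemLp f 2 P) (hg : MemLp g 2 P) :
    |∫ w, ℓ (f w) ∂P - ∫ w, ℓ (g w) ∂P| ≤ L * √(∫ w, ‖f w - g w‖ ^ 2 ∂P) := by
  rw [← integral_sub (integrable_likelihood_comp hℓ h0 hB hf.1)
    (integrable_likelihood_comp hℓ h0 hB hg.1), ← Real.norm_eq_abs]
  have hd := hf.sub hg
  calc _ ≤ ∫ w, L * ‖f w - g w‖ ∂P :=
        norm_integral_le_of_norm_le ((hd.integrable one_le_two).norm.const_mul L)
          (.of_forall fun w => hL _ _)
    _ ≤ _ := by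
        rw [integral_const_mul]
        exact mul_le_mul_of_nonneg_left (integral_norm_le_sqrt hd) hL0

/-- The difference is split as `ℓ(g)(f - g) + (ℓ(f) - ℓ(g)) f`, so that only the second moment of
`f` enters. With `f` the full process, the constant does not depend on the summary. -/
theorem norm_integral_likelihood_smul_sub_le [IsProbabilityMeasure P] (hℓ : Continuous ℓ) (h0 : ∀ v, 0 ≤ ℓ v)
    (hB : ∀ v, ℓ v ≤ B) (hL : ∀ v w, |ℓ v - ℓ w| ≤ L * ‖v - w‖) (hL0 : 0 ≤ L)
    (hf : MemLp f 2 P) (hg : MemLp g 2 P) :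
    ‖∫ w, ℓ (f w) • f w ∂P - ∫ w, ℓ (g w) • g w ∂P‖ ≤
      (B + L * √(∫ w, ‖f w‖ ^ 2 ∂P)) * √(∫ w, ‖f w - g w‖ ^ 2 ∂P) := by
  have hfi := hf.integrable one_le_two
  have hgi := hg.integrable one_le_two
  rw [← integral_sub (integrable_likelihood_smul hℓ h0 hB hfi)
    (integrable_likelihood_smul hℓ h0 hB hgi)]
  have hd : MemLp (fun w => f w - g w) 2 P := hf.sub hg
  have hB0 : 0 ≤ B := (h0 0).trans (hB 0)
  have i1 : Integrable (fun w => B * ‖f w - g w‖) P :=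
    (hd.integrable one_le_two).norm.const_mul B
  have i2 : Integrable (fun w => L * (‖f w‖ * ‖f w - g w‖)) P :=
    (hf.norm.integrable_mul hd.norm).const_mul L
  calc _ ≤ ∫ w, (B * ‖f w - g w‖ + L * (‖f w‖ * ‖f w - g w‖)) ∂P := by
        refine norm_integral_le_of_norm_le (i1.add i2) (.of_forall fun w => ?_)
        have e : ℓ (f w) • f w - ℓ (g w) • g w =
            ℓ (g w) • (f w - g w) + (ℓ (f w) - ℓ (g w)) • f w := by
          rw [smul_sub, sub_smul]; abel
        rw [e]
        refine (norm_add_le _ _).trans (add_le_add ?_ ?_)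
        · rw [norm_smul, Real.norm_of_nonneg (h0 _)]
          gcongr
          exact hB _
        · rw [norm_smul, Real.norm_eq_abs]
          calc _ ≤ L * ‖f w - g w‖ * ‖f w‖ := by gcongr; exact hL _ _
            _ = _ := by ring
    _ ≤ _ := by
        rw [integral_add i1 i2, integral_const_mul, integral_const_mul, add_mul, mul_assoc L]
        gcongr
        · exact integral_norm_le_sqrt hd
        · exact integral_norm_mul_norm_le hf hd

end Coupling

/-! ### Posterior laws as mixtures of conditional Gaussians. -/

section Mixture

variable {α : Type*} {n nStar : ℕ} (k : α → α → ℝ) (x : Fin n → α) (xStar : Fin nStar → α)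
  {Ω : Type*} [MeasurableSpace Ω] {P : Measure Ω} [IsProbabilityMeasure P]
  {f : Ω → Vec n} {ℓ : Vec n → ℝ} {B : ℝ}

instance isGaussian_condLaw (v : Vec n) : IsGaussian (condLaw k x xStar v) :=
  isGaussian_multivariateGaussian

theorem integral_condLaw (v : Vec n) :
    ∫ w, w ∂(condLaw k x xStar v) = act (gram k xStar x * (gram k x x)⁻¹) v :=
  integral_id_multivariateGaussian

-- The conditional covariance does not depend on `v`, so the centred part contributes one constant.
open scoped MatrixOrder in
theorem integral_norm_condLaw_le : ∃ c, ∀ v : Vec n,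
    ∫ w, ‖w‖ ∂(condLaw k x xStar v) ≤ ‖act (gram k xStar x * (gram k x x)⁻¹) v‖ + c := by
  refine ⟨∫ w, ‖toEuclideanCLM (𝕜 := ℝ) (CFC.sqrt
    (gram k xStar xStar - gram k xStar x * (gram k x x)⁻¹ * gram k x xStar)) w‖
    ∂(stdGaussian (Vec nStar)), fun v => ?_⟩
  unfold condLaw multivariateGaussian
  rw [integral_map (by fun_prop) (by fun_prop)]
  have hi : Integrable (fun w => toEuclideanCLM (𝕜 := ℝ) (CFC.sqrt
      (gram k xStar xStar - gram k xStar x * (gram k x x)⁻¹ * gram k x xStar)) w)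
      (stdGaussian (Vec nStar)) := ContinuousLinearMap.integrable_comp _ IsGaussian.integrable_id
  calc _ ≤ ∫ w, (‖act (gram k xStar x * (gram k x x)⁻¹) v‖ + ‖toEuclideanCLM (𝕜 := ℝ) (CFC.sqrt
        (gram k xStar xStar - gram k xStar x * (gram k x x)⁻¹ * gram k x xStar)) w‖)
        ∂(stdGaussian (Vec nStar)) :=
        integral_mono ((integrable_const _).add hi).norm ((integrable_const _).add hi.norm)
          fun w => norm_add_le _ _
    _ = _ := by rw [integral_add (integrable_const _) hi.norm]; simp

/-- The mixture of the conditional laws of `f_*` by a weighted law of `f` is a probability law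
with finite mean, and its mean is the conditional mean of the weighted mean of `f`. -/
theorem mixture_condLaw (hℓ : Continuous ℓ) (h0 : ∀ v, 0 ≤ ℓ v) (hB : ∀ v, ℓ v ≤ B)
    (hfm : Measurable f) (hf : Integrable f P) {ν : Measure (Vec nStar)}
    (hM : 0 < ∫ w, ℓ (f w) ∂P)
    (hν : ν = ENNReal.ofReal (Real.exp (-Real.log (∫ w, ℓ (f w) ∂P))) •
      (P.withDensity fun w => ENNReal.ofReal (ℓ (f w))).bind fun w => condLaw k x xStar (f w)) :
    IsProbabilityMeasure ν ∧ Integrable (fun v => v) ν ∧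
      ∫ v, v ∂ν = (∫ w, ℓ (f w) ∂P)⁻¹ •
        act (gram k xStar x * (gram k x x)⁻¹) (∫ w, ℓ (f w) • f w ∂P) := by
  set M := ∫ w, ℓ (f w) ∂P with hMdef
  have hexp : Real.exp (-Real.log M) = M⁻¹ := by rw [Real.exp_neg, Real.exp_log hM]
  let κ : Kernel Ω (Vec nStar) :=
    ⟨fun w => condLaw k x xStar (f w), (measurable_condLaw k x xStar).comp hfm⟩
  have : IsMarkovKernel κ := ⟨fun w => inferInstanceAs (IsProbabilityMeasure (condLaw k x xStar (f w)))⟩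
  have hℓf : Measurable fun w => ℓ (f w) := hℓ.measurable.comp hfm
  have hint := integrable_likelihood_comp hℓ h0 hB hf.1
  set μ := P.withDensity fun w => ENNReal.ofReal (ℓ (f w)) with hμ
  have hmass : μ Set.univ = ENNReal.ofReal M := by
    rw [hμ, withDensity_apply _ .univ, Measure.restrict_univ,
      ofReal_integral_eq_lintegral_ofReal hint (.of_forall fun w => h0 _)]
  have : IsFiniteMeasure μ := ⟨by rw [hmass]; exact ENNReal.ofReal_lt_top⟩
  have hνκ : ν = ENNReal.ofReal M⁻¹ • (κ ∘ₘ μ) := by rw [hν, hexp]; rfl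
  have hwd : ∀ h : Ω → Vec nStar, ∫ w, h w ∂μ = ∫ w, ℓ (f w) • h w ∂P := fun h => by
    rw [hμ, integral_withDensity_eq_integral_toReal_smul hℓf.ennreal_ofReal
      (.of_forall fun _ => ENNReal.ofReal_lt_top)]
    simp only [ENNReal.toReal_ofReal (h0 _)]
  have hκ : ∀ w, Integrable (fun v => v) (κ w) := fun w =>
    IsGaussian.integrable_id (μ := condLaw k x xStar (f w))
  obtain ⟨c, hc⟩ := integral_norm_condLaw_le k x xStar
  have hAf : Integrable (fun w => act (gram k xStar x * (gram k x x)⁻¹) (f w)) P := by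
    rw [act_eq_toEuclideanLin]; exact ContinuousLinearMap.integrable_comp _ hf
  -- The weight is bounded, so integrability under `P` passes to the weighted measure.
  have hle : μ ≤ ENNReal.ofReal B • P := by
    rw [hμ, ← withDensity_const]
    exact withDensity_mono (.of_forall fun w => ENNReal.ofReal_le_ofReal (hB _))
  have hcomp : Integrable (fun v => v) (κ ∘ₘ μ) := by
    rw [Measure.integrable_comp_iff (by fun_prop)]
    refine ⟨.of_forall hκ, ?_⟩
    have hs : StronglyMeasurable fun w => ∫ v, ‖v‖ ∂κ w :=
      (continuous_norm.stronglyMeasurable (α := Vec nStar)).integral_kernel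
    have : Integrable (fun w => ‖act (gram k xStar x * (gram k x x)⁻¹) (f w)‖ + c) μ :=
      ((hAf.norm.add (integrable_const c)).smul_measure ENNReal.ofReal_ne_top).mono_measure hle
    refine this.mono' hs.aestronglyMeasurable (.of_forall fun w => ?_)
    rw [Real.norm_of_nonneg (integral_nonneg fun _ => norm_nonneg _)]
    exact hc _
  have hMi : ENNReal.ofReal M⁻¹ ≠ ⊤ := ENNReal.ofReal_ne_top
  refine ⟨⟨?_⟩, ?_, ?_⟩
  · rw [hνκ, Measure.smul_apply, Measure.bind_apply .univ κ.aemeasurable]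
    simp only [measure_univ, lintegral_const, one_mul, hmass, smul_eq_mul]
    rw [← ENNReal.ofReal_mul (inv_nonneg.2 hM.le), inv_mul_cancel₀ hM.ne', ENNReal.ofReal_one]
  · rw [hνκ]
    exact hcomp.smul_measure hMi
  · have hbind : ∫ v, v ∂(κ ∘ₘ μ) = ∫ w, ∫ v, v ∂κ w ∂μ := by
      rw [Measure.comp_eq_comp_const_apply] at hcomp ⊢
      rw [Kernel.integral_comp hcomp, Kernel.const_apply]
    rw [hνκ, integral_smul_measure, hbind,
      ENNReal.toReal_ofReal (inv_nonneg.2 hM.le), hwd]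
    congr 1
    have : ∀ w, ∫ v, v ∂κ w = act (gram k xStar x * (gram k x x)⁻¹) (f w) := fun w =>
      integral_condLaw k x xStar (f w)
    simp only [this, ← act_smul]
    rw [act_eq_toEuclideanLin]
    exact ContinuousLinearMap.integral_comp_comm _ (integrable_likelihood_smul hℓ h0 hB hf)

end Mixture

/-! ### The coupling of the full prior with the feature prior. -/

section Summaries

variable {α : Type*} {n nStar : ℕ} {k : α → α → ℝ} {x : Fin n → α} {xStar : Fin nStar → α}
  {ℓ : Vec n → ℝ} {S : Summary α n}

theorem IsLikelihood.exists_bounds (hℓ : IsLikelihood ℓ) :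
    ∃ B L : ℝ, 0 ≤ L ∧ (∀ v, ℓ v ≤ B) ∧ ∀ v w, |ℓ v - ℓ w| ≤ L * ‖v - w‖ := by
  obtain ⟨B, hB⟩ := hℓ.bounded
  obtain ⟨L, hL⟩ := hℓ.bounded_gradient
  refine ⟨B, L, (norm_nonneg _).trans (hL 0), hB, fun v w => ?_⟩
  refine convex_univ.norm_image_sub_le_of_norm_fderiv_le (𝕜 := ℝ)
    (fun z _ => hℓ.differentiable z) (fun z _ => ?_) (Set.mem_univ w) (Set.mem_univ v)
  rw [← toDual_gradient, LinearIsometryEquiv.norm_map]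
  exact hL z

theorem Summary.m_le (S : Summary α n) : S.m ≤ n := by
  have : Function.Surjective S.ω := fun j => by
    obtain ⟨i, hi⟩ := Finset.card_pos.1 (S.count_pos j)
    exact ⟨i, (Finset.mem_filter.1 hi).2⟩
  simpa using Fintype.card_le_of_surjective _ this

theorem Summary.Admissible.pos (hS : S.Admissible k x) : 0 < n ∧ 0 < S.m := by
  have h : ∃ i j, residual k x S i j ≠ 0 := by
    by_contra! h
    exact hS.residual_ne_zero (Matrix.ext h)
  obtain ⟨i, j, -⟩ := h
  exact ⟨i.pos, j.pos⟩

/-- The covariance of `f` given the features is positive semidefinite. -/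
theorem schurComplement_posSemidef [TopologicalSpace α] (hk : IsCovarianceFunction k) {p q : ℕ}
    (a : Fin p → α) {b : Fin q → α} (hb : (gram k b b).PosDef) :
    (gram k a a - gram k a b * (gram k b b)⁻¹ * gram k b a).PosSemidef := by
  have hT : gram k b a = (gram k a b)ᴴ := by
    ext i j; simp [gram, hk.symm (b i)]
  have : Invertible (gram k b b) := hb.isUnit.invertible
  rw [hT, ← hb.fromBlocks₂₂ (gram k a a) (gram k a b)]
  -- By the Schur complement criterion it suffices that the block matrix is positive semidefinite;
  -- it is the Gram matrix of the concatenated points.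
  have e : fromBlocks (gram k a a) (gram k a b) (gram k a b)ᴴ (gram k b b) =
      (gram k (Fin.append a b) (Fin.append a b)).submatrix finSumFinEquiv finSumFinEquiv := by
    rw [← hT]
    ext i j
    rcases i with i | i <;> rcases j with j | j <;> simp [gram]
  rw [e]
  exact (hk.posSemidef (p + q) (Fin.append a b)).submatrix finSumFinEquiv

/-- The full prior is the law of `K_fu K_uu⁻¹ u + e` with independent noise `e`. -/
theorem map_coupling_eq_prior [TopologicalSpace α] (hk : IsCovarianceFunction k)
    (hS : S.Admissible k x) :
    ((prior k S.z).prod (multivariateGaussian 0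
      (gram k x x - gram k x S.z * (gram k S.z S.z)⁻¹ * gram k S.z x))).map
      (fun w => act (gram k x S.z * (gram k S.z S.z)⁻¹) w.1 + w.2) = prior k x := by
  have hT : gram k S.z x = (gram k x S.z)ᵀ := by
    ext i j; simp [gram, hk.symm (S.z i)]
  have hK : (gram k S.z S.z)ᵀ = gram k S.z S.z := by
    ext i j; simp [gram, hk.symm (S.z i)]
  have hu : IsUnit (gram k S.z S.z).det := (isUnit_iff_isUnit_det _).1 hS.posDef.isUnit
  rw [prior, map_act_add_prod hS.posDef.posSemidef (schurComplement_posSemidef hk x hS.posDef),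
    prior]
  congr 1
  -- The signal has covariance `K_fu K_uu⁻¹ K_uf`, exactly what the noise covariance subtracts from
  -- `K_ff`.
  rw [transpose_mul, ← hT, transpose_nonsing_inv, hK, nonsing_inv_mul_cancel_right _ _ hu,
    ← Matrix.mul_assoc, add_sub_cancel]

/-- Rescaling `u` so that its residual image has norm one makes it a competitor in the infimum `κ`.
-/
theorem norm_act_residual_sq_le (hS : S.Admissible k x) (u : Vec S.m) :
    ‖act (residual k x S) u‖ ^ 2 ≤ n / S.m * (kappa k x S)⁻¹ * ‖u‖ ^ 2 := by
  obtain ⟨hn, hm⟩ := hS.pos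
  have hn' : (0 : ℝ) < n := by exact_mod_cast hn
  have hm' : (0 : ℝ) < S.m := by exact_mod_cast hm
  set R := residual k x S with hR
  set s := (fun u : Vec S.m => (n : ℝ) / (S.m : ℝ) * ‖u‖ ^ 2) '' {u | ‖act R u‖ = 1} with hs
  have hκ : kappa k x S = sInf s := rfl
  set c := ∑ i, ∑ j, R i j ^ 2 with hc
  have hbdd : BddBelow s := ⟨0, by rintro _ ⟨v, -, rfl⟩; positivity⟩
  rcases eq_or_ne (act R u) 0 with h0 | h0
  · rw [h0, norm_zero, zero_pow two_ne_zero]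
    have : 0 ≤ kappa k x S := Real.sInf_nonneg (by rintro _ ⟨v, -, rfl⟩; positivity)
    positivity
  have hpos : 0 < ‖act R u‖ := norm_pos_iff.2 h0
  have hmem : (n : ℝ) / S.m * ‖‖act R u‖⁻¹ • u‖ ^ 2 ∈ s := by
    refine ⟨‖act R u‖⁻¹ • u, ?_, rfl⟩
    rw [Set.mem_ofPred_eq, act_smul, norm_smul, norm_inv, norm_norm, inv_mul_cancel₀ hpos.ne']
  have hcpos : 0 < c := by
    have := norm_act_sq_le R u
    by_contra! hneg
    nlinarith [sq_nonneg ‖u‖, pow_pos hpos 2]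
  -- The Frobenius bound keeps every competitor above `(n/m)/c`. Without `κ > 0` the inverse could
  -- take its default value `0` and the bound would fail.
  have hκpos : 0 < kappa k x S := by
    have hlow : (n : ℝ) / S.m / c ≤ sInf s := by
      refine le_csInf ⟨_, hmem⟩ ?_
      rintro _ ⟨v, hv, rfl⟩
      have h1 := norm_act_sq_le R v
      rw [show ‖act R v‖ = 1 from hv, one_pow] at h1
      rw [div_le_iff₀ hcpos, mul_assoc]
      exact le_mul_of_one_le_right (by positivity) (by linarith)
    rw [hκ]
    exact lt_of_lt_of_le (by positivity) hlow
  have h := csInf_le hbdd hmem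
  rw [← hκ, norm_smul, norm_inv, norm_norm, mul_pow, inv_pow] at h
  have e : (n : ℝ) / S.m * ((‖act R u‖ ^ 2)⁻¹ * ‖u‖ ^ 2) =
      n / S.m * ‖u‖ ^ 2 / ‖act R u‖ ^ 2 := by field_simp
  rw [e, le_div_iff₀ (by positivity)] at h
  rw [mul_right_comm, ← div_eq_mul_inv, le_div_iff₀ hκpos]
  linarith

/-! ### Lower bounds for `η`. -/

theorem xi₀_pos : 0 < xi₀ := by
  by_contra! h
  have h1 : 2 * Real.sqrt (Real.pi * xi₀) * Real.exp (-xi₀) = 1 := xi₀_isGreatest.1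
  rw [Real.sqrt_eq_zero_of_nonpos (mul_nonpos_of_nonneg_of_nonpos Real.pi_pos.le h)] at h1
  norm_num at h1

theorem chiSqTail_nonneg (a : ℕ) {b : ℝ} (hb : 0 ≤ b) : 0 ≤ chiSqTail a b := by
  have h : ∀ c : ℝ, 0 ≤ c →
      0 ≤ ∫ t in Set.Ioi c, t ^ ((a : ℝ) / 2 - 1) * Real.exp (-t) := fun c hc =>
    setIntegral_nonneg measurableSet_Ioi fun t ht => by
      have : 0 < t := hc.trans_lt ht
      positivity
  exact mul_nonneg (inv_nonneg.2 (h 0 le_rfl)) (h _ (by positivity))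

/-- Both square roots are nondecreasing in `ξ` and the chi-square tail is nonnegative, so every
member of the infimum dominates the square roots at `ξ₀`. -/
theorem sqrt_add_sqrt_le_eta (k : α → α → ℝ) (x : Fin n → α) (S : Summary α n) :
    √(xi₀ * (lambda₁ k S * (kappa k x S)⁻¹)) + √(xi₀ * lambda₂ k x S) ≤ eta k x S := by
  have : Nonempty (Set.Ici xi₀) := ⟨⟨xi₀, Set.self_mem_Ici⟩⟩
  refine le_ciInf fun ⟨ξ, hξ⟩ => ?_
  have hξ' : xi₀ ≤ ξ := hξ
  have hmono : ∀ c : ℝ, √(xi₀ * c) ≤ √(ξ * c) := fun c => by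
    rw [Real.sqrt_mul xi₀_pos.le, Real.sqrt_mul (xi₀_pos.le.trans hξ')]
    gcongr
  have h3 := chiSqTail_nonneg S.m
    (mul_nonneg (xi₀_pos.le.trans hξ') (Nat.cast_nonneg (α := ℝ) S.m))
  rw [mul_assoc]
  linarith [hmono (lambda₁ k S * (kappa k x S)⁻¹), hmono (lambda₂ k x S)]

theorem eta_nonneg (k : α → α → ℝ) (x : Fin n → α) (S : Summary α n) : 0 ≤ eta k x S :=
  (by positivity : (0 : ℝ) ≤ _).trans (sqrt_add_sqrt_le_eta k x S)

theorem le_eta_sq (k : α → α → ℝ) (x : Fin n → α) (S : Summary α n) :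
    xi₀ * (lambda₁ k S * (kappa k x S)⁻¹ + lambda₂ k x S) ≤ eta k x S ^ 2 := by
  have h : ∀ c : ℝ, c ≤ √c ^ 2 := fun c => by
    rw [Real.sq_sqrt']; exact le_max_left _ _
  have h1 := h (xi₀ * (lambda₁ k S * (kappa k x S)⁻¹))
  have h2 := h (xi₀ * lambda₂ k x S)
  have h3 := pow_le_pow_left₀ (by positivity) (sqrt_add_sqrt_le_eta k x S) 2
  have h4 := mul_nonneg (Real.sqrt_nonneg (xi₀ * (lambda₁ k S * (kappa k x S)⁻¹)))
    (Real.sqrt_nonneg (xi₀ * lambda₂ k x S))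
  nlinarith

/-! ### The coupling estimates. -/

/-- The mean square distance between the values of the process at the inputs and the assigned
values at the features, under the coupling. -/
theorem integral_coupling_sq_le [TopologicalSpace α] (hk : IsCovarianceFunction k)
    (hS : S.Admissible k x) :
    ∫ w, ‖(act (gram k x S.z * (gram k S.z S.z)⁻¹) w.1 + w.2) - act S.W w.1‖ ^ 2
      ∂((prior k S.z).prod (multivariateGaussian 0
        (gram k x x - gram k x S.z * (gram k S.z S.z)⁻¹ * gram k S.z x))) ≤
      2 * n / xi₀ * eta k x S ^ 2 := by
  obtain ⟨hn, hm⟩ := hS.pos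
  have hm' : (0 : ℝ) < S.m := by exact_mod_cast hm
  have hT := schurComplement_posSemidef hk x hS.posDef
  set T := gram k x x - gram k x S.z * (gram k S.z S.z)⁻¹ * gram k S.z x with hTdef
  set b : ℝ := n / S.m * (kappa k x S)⁻¹ with hb
  have hκ : 0 ≤ kappa k x S := Real.sInf_nonneg (by rintro _ ⟨v, -, rfl⟩; positivity)
  have hb0 : 0 ≤ b := by positivity
  have i1 : Integrable (fun u : Vec S.m => ‖u‖ ^ 2) (prior k S.z) :=
    (memLp_multivariateGaussian 0 _).integrable_norm_pow two_ne_zero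
  have i2 : Integrable (fun u : Vec n => ‖u‖ ^ 2) (multivariateGaussian 0 T) :=
    (memLp_multivariateGaussian 0 _).integrable_norm_pow two_ne_zero
  have : IsProbabilityMeasure (prior k S.z) := by unfold prior; infer_instance
  have j1 : Integrable (fun w : Vec S.m × Vec n => 2 * b * ‖w.1‖ ^ 2)
      ((prior k S.z).prod (multivariateGaussian 0 T)) := (i1.comp_fst _).const_mul _
  have j2 : Integrable (fun w : Vec S.m × Vec n => 2 * ‖w.2‖ ^ 2)
      ((prior k S.z).prod (multivariateGaussian 0 T)) := (i2.comp_snd _).const_mul _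
  calc _ ≤ ∫ w, (2 * b * ‖w.1‖ ^ 2 + 2 * ‖w.2‖ ^ 2)
        ∂((prior k S.z).prod (multivariateGaussian 0 T)) := by
        refine integral_mono_of_nonneg (.of_forall fun w => by positivity) (j1.add j2)
          (.of_forall fun w => ?_)
        have e : (act (gram k x S.z * (gram k S.z S.z)⁻¹) w.1 + w.2) - act S.W w.1 =
            w.2 - act (residual k x S) w.1 := by
          rw [residual, act_sub_left]; abel
        have h1 := norm_act_residual_sq_le hS w.1
        have h2 := norm_sub_le w.2 (act (residual k x S) w.1)
        have h3 := pow_le_pow_left₀ (norm_nonneg _) h2 2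
        simp only [e]
        nlinarith [sq_nonneg (‖w.2‖ - ‖act (residual k x S) w.1‖)]
    _ = 2 * b * (gram k S.z S.z).trace + 2 * T.trace := by
        rw [integral_add j1 j2, integral_const_mul, integral_const_mul,
          integral_fun_fst (fun u : Vec S.m => ‖u‖ ^ 2),
          integral_fun_snd (fun u : Vec n => ‖u‖ ^ 2), prior,
          integral_norm_sq_multivariateGaussian hS.posDef.posSemidef,
          integral_norm_sq_multivariateGaussian hT]
        simp
    _ ≤ 2 * b * (S.m * lambda₁ k S) + 2 * (n * lambda₂ k x S) := by
        have h1 := trace_le_maxEigenvalue hS.posDef.1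
        have h2 := trace_le_maxEigenvalue hT.1
        have h3 := mul_le_mul_of_nonneg_left h1 hb0
        rw [lambda₁, lambda₂, ← hTdef]
        linarith
    -- The factor `m` from the trace cancels the `n/m` in the normalization of `κ`, leaving `n` in
    -- front of both eigenvalues.
    _ = 2 * n / xi₀ * (xi₀ * (lambda₁ k S * (kappa k x S)⁻¹ + lambda₂ k x S)) := by
        have := xi₀_pos.ne'
        rw [hb]; field_simp
    _ ≤ _ := by
        have := xi₀_pos
        gcongr
        exact le_eta_sq k x S

instance isProbabilityMeasure_prior (k : α → α → ℝ) {p : ℕ} (a : Fin p → α) :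
    IsProbabilityMeasure (prior k a) := by unfold prior; infer_instance

theorem memLp_prior (k : α → α → ℝ) {p : ℕ} (a : Fin p → α) :
    MemLp (fun u => u) 2 (prior k a) :=
  memLp_multivariateGaussian 0 _

theorem memLp_act_prior (k : α → α → ℝ) {p q : ℕ} (a : Fin q → α)
    (A : Matrix (Fin p) (Fin q) ℝ) : MemLp (fun u => act A u) 2 (prior k a) := by
  rw [act_eq_toEuclideanLin]
  exact ContinuousLinearMap.comp_memLp' _ (memLp_prior k a)

/-- Both the marginal likelihoods and the unnormalized posterior means are `O(η)`-close. -/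
theorem exists_coupling_bounds [TopologicalSpace α] (hk : IsCovarianceFunction k)
    (x : Fin n → α) (hℓ : IsLikelihood ℓ) :
    ∃ a b : ℝ, 0 ≤ a ∧ 0 ≤ b ∧ ∀ S : Summary α n, S.Admissible k x →
      |marginal k x ℓ - reprMarginal k ℓ S| ≤ a * eta k x S ∧
      ‖∫ f, ℓ f • f ∂(prior k x) - ∫ u, ℓ (act S.W u) • act S.W u ∂(prior k S.z)‖ ≤
        b * eta k x S := by
  obtain ⟨B, L, hL0, hB, hL⟩ := hℓ.exists_bounds
  have hB0 : 0 ≤ B := (hℓ.nonneg 0).trans (hB 0)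
  have hc := hℓ.differentiable.continuous
  refine ⟨L * √(2 * n / xi₀), (B + L * √(∫ f, ‖f‖ ^ 2 ∂(prior k x))) * √(2 * n / xi₀),
    by positivity, by positivity, fun S hS => ?_⟩
  have hmap := map_coupling_eq_prior hk hS
  have hdist := integral_coupling_sq_le hk hS
  set T := gram k x x - gram k x S.z * (gram k S.z S.z)⁻¹ * gram k S.z x
  set P := (prior k S.z).prod (multivariateGaussian 0 T) with hP
  set g : Vec S.m × Vec n → Vec n :=
    fun w => act (gram k x S.z * (gram k S.z S.z)⁻¹) w.1 + w.2 with hg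
  have hgm : Measurable g :=
    (((continuous_act _).comp continuous_fst).add continuous_snd).measurable
  have hg2 : MemLp g 2 P := by
    have := memLp_prior k x
    rw [← hmap, memLp_map_measure_iff (by fun_prop) hgm.aemeasurable] at this
    exact this
  have hh2 : MemLp (fun w : Vec S.m × Vec n => act S.W w.1) 2 P :=
    (memLp_act_prior k S.z S.W).comp_fst _
  have hsqrt : √(∫ w, ‖g w - act S.W w.1‖ ^ 2 ∂P) ≤ √(2 * n / xi₀) * eta k x S := by
    refine (Real.sqrt_le_sqrt hdist).trans_eq ?_
    rw [Real.sqrt_mul (div_nonneg (by positivity) xi₀_pos.le), Real.sqrt_sq (eta_nonneg k x S)]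
  have e1 : marginal k x ℓ = ∫ w, ℓ (g w) ∂P := by
    rw [marginal, ← hmap, integral_map hgm.aemeasurable (by fun_prop)]
  have e2 : reprMarginal k ℓ S = ∫ w, ℓ (act S.W w.1) ∂P := by
    rw [reprMarginal, integral_fun_fst (fun u : Vec S.m => ℓ (act S.W u))]; simp
  have e3 : ∫ f, ℓ f • f ∂(prior k x) = ∫ w, ℓ (g w) • g w ∂P := by
    rw [← hmap, integral_map hgm.aemeasurable (by fun_prop)]
  have e4 : ∫ u, ℓ (act S.W u) • act S.W u ∂(prior k S.z) =
      ∫ w, ℓ (act S.W w.1) • act S.W w.1 ∂P := by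
    rw [integral_fun_fst (fun u : Vec S.m => ℓ (act S.W u) • act S.W u)]; simp
  have e5 : ∫ f, ‖f‖ ^ 2 ∂(prior k x) = ∫ w, ‖g w‖ ^ 2 ∂P := by
    rw [← hmap, integral_map hgm.aemeasurable (by fun_prop)]
  rw [e1, e2, e3, e4, e5, mul_assoc, mul_assoc]
  exact ⟨(abs_integral_likelihood_sub_le hc hℓ.nonneg hB hL hL0 hg2 hh2).trans (by gcongr),
    (norm_integral_likelihood_smul_sub_le hc hℓ.nonneg hB hL hL0 hg2 hh2).trans (by gcongr)⟩

/-! ### From integrals to logarithms and posterior means. -/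

theorem abs_log_sub_log_le {a b c : ℝ} (hc : 0 < c) (ha : c ≤ a) (hb : c ≤ b) :
    |Real.log a - Real.log b| ≤ |a - b| / c := by
  have h : ∀ a b : ℝ, c ≤ a → c ≤ b → Real.log a - Real.log b ≤ |a - b| / c := fun a b ha hb => by
    have ha' := hc.trans_le ha
    have hb' := hc.trans_le hb
    rw [← Real.log_div ha'.ne' hb'.ne']
    calc Real.log (a / b) ≤ a / b - 1 := Real.log_le_sub_one_of_pos (by positivity)
      _ = (a - b) / b := by field_simp
      _ ≤ |a - b| / b := by gcongr; exact le_abs_self _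
      _ ≤ |a - b| / c := by gcongr
  rw [abs_le']
  refine ⟨h a b ha hb, ?_⟩
  rw [neg_sub, abs_sub_comm]
  exact h b a hb ha

theorem norm_inv_smul_sub_le {E : Type*} [NormedAddCommGroup E] [NormedSpace ℝ E] {a b c : ℝ}
    (hc : 0 < c) (ha : c ≤ a) (hb : c ≤ b) (u v : E) :
    ‖a⁻¹ • u - b⁻¹ • v‖ ≤ c⁻¹ * ‖u - v‖ + c⁻¹ * c⁻¹ * |a - b| * ‖u‖ := by
  have ha' := hc.trans_le ha
  have hb' := hc.trans_le hb
  have e : a⁻¹ • u - b⁻¹ • v = b⁻¹ • (u - v) + (a⁻¹ * b⁻¹ * (b - a)) • u := by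
    have : a⁻¹ * b⁻¹ * (b - a) = a⁻¹ - b⁻¹ := by field_simp
    rw [this, sub_smul, smul_sub]; abel
  rw [e]
  refine (norm_add_le _ _).trans ?_
  rw [norm_smul, norm_smul, norm_mul, norm_mul, Real.norm_of_nonneg (inv_nonneg.2 ha'.le),
    Real.norm_of_nonneg (inv_nonneg.2 hb'.le), Real.norm_eq_abs, abs_sub_comm b a]
  gcongr

/-- A nonsingular Gaussian charges the nonempty open set where the continuous likelihood is nonzero.
-/
theorem marginal_pos (hx : (gram k x x).PosDef) (hℓ : IsLikelihood ℓ) (hne : ∃ f, ℓ f ≠ 0) :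
    0 < marginal k x ℓ := by
  obtain ⟨B, L, hL0, hB, hL⟩ := hℓ.exists_bounds
  have hc := hℓ.differentiable.continuous
  have : (prior k x).IsOpenPosMeasure := isOpenPosMeasure_multivariateGaussian hx
  rw [marginal, integral_pos_iff_support_of_nonneg hℓ.nonneg
    (integrable_likelihood_comp (f := fun f => f) hc hℓ.nonneg hB (by fun_prop))]
  exact hc.isOpen_support.measure_pos _ hne

/-- Where the marginal likelihood of the summarized model is bounded below, both errors are
`O(η)`. -/
theorem exists_bounds_of_le_reprMarginal [TopologicalSpace α] (hk : IsCovarianceFunction k)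
    (hℓ : IsLikelihood ℓ) (xStar : Fin nStar → α) {c : ℝ} (hc : 0 < c)
    (hM : c ≤ marginal k x ℓ) :
    ∃ C > 0, ∀ S : Summary α n, S.Admissible k x → c ≤ reprMarginal k ℓ S →
      S.Bounds k x xStar ℓ C := by
  obtain ⟨a, b, ha, hb, hab⟩ := exists_coupling_bounds hk x hℓ
  obtain ⟨B, L, hL0, hB, hL⟩ := hℓ.exists_bounds
  have hcont := hℓ.differentiable.continuous
  set N := ∫ f, ℓ f • f ∂(prior k x) with hN
  set A := gram k xStar x * (gram k x x)⁻¹ with hA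
  set A' := LinearMap.toContinuousLinearMap (toEuclideanLin A) with hA'
  have hfull := mixture_condLaw k x xStar (P := prior k x) (f := fun f => f) hcont hℓ.nonneg hB
    measurable_id ((memLp_prior k x).integrable one_le_two) (hc.trans_le hM) rfl
  -- The first two terms serve the two errors; the `+ 1` only makes the constant positive.
  refine ⟨a / c + ‖A'‖ * (c⁻¹ * b + c⁻¹ * c⁻¹ * a * ‖N‖) + 1, by positivity, fun S hS hS' => ?_⟩
  obtain ⟨h1, h2⟩ := hab S hS
  have hη := eta_nonneg k x S
  obtain ⟨p1, p2, p3⟩ := mixture_condLaw k x xStar (P := prior k S.z) (f := act S.W)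
    (ν := reprPosterior k x xStar ℓ S) hcont hℓ.nonneg hB
    (continuous_act _).measurable ((memLp_act_prior k S.z S.W).integrable one_le_two)
    (hc.trans_le hS') rfl
  have q1 : 0 ≤ a / c * eta k x S := by positivity
  have q2 : 0 ≤ ‖A'‖ * (c⁻¹ * b + c⁻¹ * c⁻¹ * a * ‖N‖) * eta k x S := by positivity
  refine ⟨hc.trans_le hS', ?_, p1, p2, ?_⟩
  · have : |logMarginal k x ℓ - reprLogMarginal k ℓ S| ≤ a / c * eta k x S :=
      (abs_log_sub_log_le hc hM hS').trans (by rw [div_mul_eq_mul_div]; gcongr)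
    linarith
  · have hp : ∫ v, v ∂(posterior k x xStar ℓ) = (marginal k x ℓ)⁻¹ • act A N := hfull.2.2
    rw [p3, hp, act_eq_toEuclideanLin, ← hA', ← map_smul, ← map_smul, ← map_sub]
    have : ‖A' ((marginal k x ℓ)⁻¹ • N - (reprMarginal k ℓ S)⁻¹ •
        ∫ u, ℓ (act S.W u) • act S.W u ∂(prior k S.z))‖ ≤
        ‖A'‖ * (c⁻¹ * b + c⁻¹ * c⁻¹ * a * ‖N‖) * eta k x S := by
      refine (A'.le_opNorm _).trans ?_
      rw [mul_assoc]
      gcongr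
      refine (norm_inv_smul_sub_le hc hM hS' _ _).trans ?_
      calc _ ≤ c⁻¹ * (b * eta k x S) + c⁻¹ * c⁻¹ * (a * eta k x S) * ‖N‖ := by gcongr
        _ = _ := by ring
    exact this.trans (by linarith)

/-! ### Lower bound for the summarized marginal likelihood. -/

/-- Only finitely many dimensions occur, as `m ≤ n` for every summary, so the minimum of the ball
masses is positive. -/
theorem exists_le_stdGaussian_ball (n : ℕ) {r : ℝ} (hr : 0 < r) :
    ∃ δ > 0, ∀ m ≤ n, δ ≤ (stdGaussian (Vec m)).real (Metric.ball 0 r) := by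
  have hpos : ∀ m, 0 < (stdGaussian (Vec m)).real (Metric.ball 0 r) := fun m => by
    have := isOpenPosMeasure_stdGaussian m
    exact ENNReal.toReal_pos (Metric.isOpen_ball.measure_pos _ (Metric.nonempty_ball.2 hr)).ne'
      (measure_ne_top _ _)
  induction n with
  | zero => exact ⟨_, hpos 0, fun m hm => by rw [Nat.le_zero.1 hm]⟩
  | succ n ih =>
    obtain ⟨δ, hδ, h⟩ := ih
    refine ⟨min δ _, lt_min hδ (hpos (n + 1)), fun m hm => ?_⟩
    rcases Nat.le_succ_iff.1 hm with hm | rfl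
    · exact (min_le_left _ _).trans (h m hm)
    · exact min_le_right _ _

open scoped MatrixOrder in
/-- If the likelihood is positive at the origin, the marginal likelihood of the summarized model
is bounded below over all features with bounded prior variance. -/
theorem exists_le_reprMarginal (hℓ : IsLikelihood ℓ) (h0 : 0 < ℓ 0) (x : Fin n → α) (B : ℝ) :
    ∃ δ > 0, ∀ S : Summary α n, S.Admissible k x → (∀ j, k (S.z j) (S.z j) ≤ B) →
      δ ≤ reprMarginal k ℓ S := by
  obtain ⟨B', L, hL0, hB', hL⟩ := hℓ.exists_bounds
  have hcont := hℓ.differentiable.continuous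
  have hb : 0 < n * |B| + 1 := by positivity
  have hnb : (0 : ℝ) < (n * n + 1) * (n * |B| + 1) := by positivity
  obtain ⟨ε, hε, hball⟩ := Metric.continuousAt_iff.1 hcont.continuousAt (ℓ 0 / 2) (half_pos h0)
  -- With `u = √K_uu v` and `v` standard Gaussian, `|W u|²` is at most `(n² + 1)(n|B| + 1)|v|²`: a
  -- Frobenius bound for `W` times a trace bound. This radius thus forces `|W u| < ε`, where `ℓ`
  -- exceeds half its value at the origin. The added ones keep the denominator positive.
  set r := ε / √((n * n + 1) * (n * |B| + 1)) with hr
  have hr0 : 0 < r := div_pos hε (Real.sqrt_pos.2 hnb)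
  obtain ⟨δ, hδ, hδm⟩ := exists_le_stdGaussian_ball n hr0
  refine ⟨ℓ 0 / 2 * δ, by positivity, fun S hS hSB => ?_⟩
  have hmn : (S.m : ℝ) ≤ n := by exact_mod_cast S.m_le
  set V := CFC.sqrt (gram k S.z S.z) with hV
  have htr : (gram k S.z S.z).trace ≤ n * |B| + 1 := by
    calc (gram k S.z S.z).trace ≤ ∑ _j : Fin S.m, |B| :=
          Finset.sum_le_sum fun j _ => (hSB j).trans (le_abs_self B)
      _ = S.m * |B| := by simp
      _ ≤ n * |B| := by gcongr
      _ ≤ _ := by linarith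
  have hW : ∑ i, ∑ j, S.W i j ^ 2 ≤ (n : ℝ) * n + 1 := by
    calc ∑ i, ∑ j, S.W i j ^ 2 ≤ ∑ _i : Fin n, ∑ _j : Fin S.m, (1 : ℝ) := by
          refine Finset.sum_le_sum fun i _ => Finset.sum_le_sum fun j _ => ?_
          simp only [Summary.W, of_apply]
          split_ifs <;> simp
      _ = n * S.m := by simp
      _ ≤ n * n := by gcongr
      _ ≤ _ := by linarith
  have hlow : ∀ v ∈ Metric.ball (0 : Vec S.m) r, ℓ 0 / 2 ≤ ℓ (act S.W (act V v)) := by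
    intro v hv
    rw [mem_ball_zero_iff] at hv
    have h1 : ‖act S.W (act V v)‖ ^ 2 < ε ^ 2 := by
      calc _ ≤ (∑ i, ∑ j, S.W i j ^ 2) * ‖act V v‖ ^ 2 := norm_act_sq_le _ _
        _ ≤ (n * n + 1) * ((n * |B| + 1) * ‖v‖ ^ 2) := by
            gcongr
            exact (norm_act_sqrt_sq_le hS.posDef.posSemidef v).trans (by gcongr)
        _ = (n * n + 1) * (n * |B| + 1) * ‖v‖ ^ 2 := by ring
        _ < (n * n + 1) * (n * |B| + 1) * r ^ 2 := by gcongr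
        _ = ε ^ 2 := by
            rw [hr, div_pow, Real.sq_sqrt hnb.le]; field_simp
    have h2 := hball (x := act S.W (act V v)) (by
      rw [dist_zero_right]; exact lt_of_pow_lt_pow_left₀ 2 hε.le h1)
    rw [Real.dist_eq, abs_lt] at h2
    linarith
  have hVm := (continuous_act V).measurable
  have e : reprMarginal k ℓ S = ∫ v, ℓ (act S.W (act V v)) ∂(stdGaussian (Vec S.m)) := by
    rw [reprMarginal, prior, multivariateGaussian_zero_eq_map, integral_map hVm.aemeasurable]
    exact (hcont.comp (continuous_act S.W)).aestronglyMeasurable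
  rw [e]
  have hint : Integrable (fun v => ℓ (act S.W (act V v))) (stdGaussian (Vec S.m)) :=
    integrable_likelihood_comp hcont hℓ.nonneg hB'
      ((continuous_act _).comp (continuous_act V)).aestronglyMeasurable
  calc ℓ 0 / 2 * δ ≤ ℓ 0 / 2 * (stdGaussian (Vec S.m)).real (Metric.ball 0 r) := by
        gcongr; exact hδm _ S.m_le
    _ = ∫ _v in Metric.ball (0 : Vec S.m) r, ℓ 0 / 2 ∂(stdGaussian (Vec S.m)) := by
        rw [setIntegral_const, smul_eq_mul, mul_comm]
    _ ≤ ∫ v in Metric.ball (0 : Vec S.m) r, ℓ (act S.W (act V v)) ∂(stdGaussian (Vec S.m)) :=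
        setIntegral_mono_on (integrable_const _).integrableOn hint.integrableOn
          measurableSet_ball hlow
    _ ≤ _ := setIntegral_le_integral hint (.of_forall fun v => hℓ.nonneg _)

end Summaries

end GPSummary

end

/-! ### The two regimes. -/

open GPSummary in
theorem mainTheorem1
    {d n nStar : ℕ} (𝒳 : Set (EuclideanSpace ℝ (Fin d))) {𝒴 : Type*}
    -- the covariance function (with its hyperparameters), the inputs, and the new inputs
    (k : 𝒳 → 𝒳 → ℝ) (hk : IsCovarianceFunction k)
    (x : Fin n → 𝒳) (hx : (gram k x x).PosDef) (xStar : Fin nStar → 𝒳)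
    -- the likelihood `p(y | f)` and the outputs
    (p : (Fin n → 𝒴) → Vec n → ℝ) (y : Fin n → 𝒴)
    (hp : IsLikelihood (p y)) (hp_ne : ∃ f, p y f ≠ 0) :
    -- `𝓛` and the posterior mean of the full model are genuine
    (0 < marginal k x (p y) ∧ IsProbabilityMeasure (posterior k x xStar (p y)) ∧
      Integrable (fun v => v) (posterior k x xStar (p y))) ∧
    -- both errors are `O(η)` as `η → 0`, uniformly over all summarized data
    (∃ C > 0, ∃ η₀ > 0, ∀ S : Summary 𝒳 n, S.Admissible k x →
      eta k x S ≤ η₀ → S.Bounds k x xStar (p y) C) ∧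
    -- if the likelihood does not vanish at the origin, no smallness of `η` is needed: they are
    -- `O(η)` uniformly over all summarized data whose features have bounded prior variance
    (0 < p y 0 → ∀ B : ℝ, ∃ C > 0, ∀ S : Summary 𝒳 n, S.Admissible k x →
      (∀ j, k (S.z j) (S.z j) ≤ B) → S.Bounds k x xStar (p y) C) := by
  have hM := marginal_pos hx hp hp_ne
  obtain ⟨B', L, -, hB', -⟩ := hp.exists_bounds
  have hfull := mixture_condLaw k x xStar (P := prior k x) (f := fun f => f)
    (ν := posterior k x xStar (p y)) hp.differentiable.continuous hp.nonneg hB'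
    measurable_id ((memLp_prior k x).integrable one_le_two) hM rfl
  refine ⟨⟨hM, hfull.1, hfull.2.1⟩, ?_, fun h0 B => ?_⟩
  · obtain ⟨a, b, ha, -, hab⟩ := exists_coupling_bounds hk x hp
    obtain ⟨C, hC, h⟩ := exists_bounds_of_le_reprMarginal hk hp xStar (half_pos hM)
      (half_le_self hM.le)
    -- For such `η` the error `a η` is at most half the full marginal likelihood, so the summarized
    -- one keeps the other half. The `+ 1` covers `a = 0`.
    refine ⟨C, hC, marginal k x (p y) / 2 / (a + 1), by positivity, fun S hS hη => h S hS ?_⟩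
    have h1 := (abs_le.1 (hab S hS).1).2
    rw [le_div_iff₀ (by positivity)] at hη
    nlinarith [eta_nonneg k x S]
  · obtain ⟨δ, hδ, hlow⟩ := exists_le_reprMarginal hp h0 x B
    obtain ⟨C, hC, h⟩ := exists_bounds_of_le_reprMarginal hk hp xStar (lt_min hδ hM)
      (min_le_right _ _)
    exact ⟨C, hC, fun S hS hSB => h S hS ((min_le_left _ _).trans (hlow S hS hSB))⟩
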